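/- Let $R$ be an associative ring with $1$, not necessarily commutative, and let $M$ be a (unital) right $R$-module. For a regular uncountable cardinal $\kappa$, a *$\kappa$-dense system* in $M$ is a directed family $\mathcal C$ of submodules of $M$ that is closed under unions of (nonempty) well-ordered ascending chains of length $<\kappa$ and such that every subset of $M$ of cardinality $<\kappa$ is contained in an element of $\mathcal C$. The module $M$ is *$\kappa$-projective* if it has a $\kappa$-dense system consisting of projective submodules each of which has a generating set of cardinality $<\kappa$. The module $M$ is *Mittag--Leffler* if for each family $(Q_i)_{i\in I}$ of left $R$-modules the canonical map $M\otimes_R\prod_{i\in I}Q_i\to\prod_{i\in I}(M\otimes_R Q_i)$ is injective. Then: (i) $M$ is $\aleph_1$-projective if and only if $M$ is a flat Mittag--Leffler module. (ii) If $\kappa$ is a regular uncountable cardinal and $M$ is $\kappa$-projective, then $M$ is a flat Mittag--Leffler module. -/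

import Mathlib

open scoped TensorProduct

/-!
Right `R`-modules are modules over `Rᵐᵒᵖ`, so `m r` is written `MulOpposite.op r • m`;
left `R`-modules are modules over `R`.
-/

universe u v w w'

namespace MLModule

section Tensor

variable (R : Type u) [Ring R] (M : Type v) [AddCommGroup M] [Module Rᵐᵒᵖ M]

/-- The subgroup of `M ⊗_ℤ Q` generated by all `m r ⊗ q - m ⊗ r q`. -/
def balancedRel (Q : Type w) [AddCommGroup Q] [Module R Q] : AddSubgroup (M ⊗[ℤ] Q) :=
  AddSubgroup.closure
    {x | ∃ (m : M) (r : R) (q : Q), x = (MulOpposite.op r • m) ⊗ₜ[ℤ] q - m ⊗ₜ[ℤ] (r • q)}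

/-- The tensor product `M ⊗_R Q` of a right module and a left module over a ring `R` that need
not be commutative, an abelian group. -/
abbrev Tensor (Q : Type w) [AddCommGroup Q] [Module R Q] : Type (max v w) :=
  (M ⊗[ℤ] Q) ⧸ balancedRel R M Q

variable {R}

/-- The map `M ⊗_R f : M ⊗_R Q → M ⊗_R Q'`, `m ⊗ q ↦ m ⊗ f q`. -/
def Tensor.map {Q : Type w} [AddCommGroup Q] [Module R Q] {Q' : Type w'} [AddCommGroup Q']
    [Module R Q'] (f : Q →ₗ[R] Q') : Tensor R M Q →+ Tensor R M Q' :=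
  QuotientAddGroup.map (balancedRel R M Q) (balancedRel R M Q')
    (TensorProduct.map (LinearMap.id : M →ₗ[ℤ] M)
      f.toAddMonoidHom.toIntLinearMap).toAddMonoidHom (by
        rw [balancedRel, AddSubgroup.closure_le]
        rintro _ ⟨m, r, q, rfl⟩
        exact AddSubgroup.subset_closure ⟨m, r, f q, by simp⟩)

variable (R)

/-- The canonical map `ρ : M ⊗_R ∏ Q_i → ∏ (M ⊗_R Q_i)`, `m ⊗ (q_i) ↦ (m ⊗ q_i)`. -/
def rho {I : Type w'} (Q : I → Type w) [∀ i, AddCommGroup (Q i)] [∀ i, Module R (Q i)] :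
    Tensor R M (∀ i, Q i) →+ ∀ i, Tensor R M (Q i) :=
  AddMonoidHom.pi fun i => Tensor.map M (LinearMap.proj (R := R) (φ := Q) i)

/-- The right module `M` is flat: `M ⊗_R -` preserves monomorphisms of left modules
(in the universe `w`). -/
def IsFlat : Prop :=
  ∀ (N P : Type w) [AddCommGroup N] [AddCommGroup P] [Module R N] [Module R P] (f : N →ₗ[R] P),
    Function.Injective f → Function.Injective (Tensor.map M f)

/-- The right module `M` is Mittag-Leffler: `ρ` is monic for each family of left modules
(in the universe `w`). -/
def IsMittagLeffler : Prop :=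
  ∀ (I : Type w) (Q : I → Type w) [∀ i, AddCommGroup (Q i)] [∀ i, Module R (Q i)],
    Function.Injective (rho R M Q)

end Tensor

section Dense

variable {S : Type u} [Ring S] {M : Type v} [AddCommGroup M] [Module S M]

/-- A `κ`-dense system of submodules of `M`. The supremum in `chain` is the union, since the
family is a nonempty chain; a well-ordered set has order type `< κ` iff it has fewer than `κ`
elements. -/
structure IsDenseSystem (κ : Cardinal.{v}) (C : Set (Submodule S M)) : Prop where
  directed : DirectedOn (· ≤ ·) C
  chain : ∀ (ι : Type v) [LinearOrder ι] [WellFoundedLT ι] [Nonempty ι], Cardinal.mk ι < κ →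
    ∀ F : ι → Submodule S M, Monotone F → (∀ i, F i ∈ C) → (⨆ i, F i) ∈ C
  cover : ∀ X : Set M, Cardinal.mk X < κ → ∃ N ∈ C, X ⊆ (N : Set M)

/-- The submodule `N` has a generating set with fewer than `κ` elements. -/
def IsLTGenerated (κ : Cardinal.{v}) (N : Submodule S M) : Prop :=
  ∃ X : Set M, Cardinal.mk X < κ ∧ Submodule.span S X = N

variable (S M)

/-- `M` has a `κ`-dense system of `< κ`-generated projective submodules
(used for `κ` regular and uncountable). -/
def IsKappaProjective (κ : Cardinal.{v}) : Prop :=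
  ∃ C : Set (Submodule S M), IsDenseSystem κ C ∧
    ∀ N ∈ C, IsLTGenerated κ N ∧ Module.Projective S N

end Dense

end MLModule

/-!
A module `M` is flat Mittag-Leffler iff `M ⊗_R -` preserves jointly injective families of maps.
Projective modules have this property. If a tensor over a `κ`-projective module violated it, one
could climb an `ω`-chain in the dense system along which the tensor dies under one more map of the
family at every step; its union is again projective, so the tensor would die under all these maps
at a finite stage, a contradiction.

Conversely, over a flat Mittag-Leffler module every tuple has a smallest left submodule of `R^n`
supporting it, its content. Writing the tuple with elements of the content gives, for each map from
a finitely generated free module, a factorization whose first map factors through that of every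
other one. A countably generated submodule can be closed under such factorizations in `ω` steps, and
a countably generated module that has them is projective, because lifting problems can be solved
step by step along a chain.
-/

namespace MLModule

section Module

variable {S : Type*} [Ring S] {P : Type*} [AddCommGroup P] [Module S P] {ι : Type*}

theorem exists_dual_basis_on [Module.Projective S P] [Finite ι] (x : ι → P) :
    ∃ (A : Finset P) (φ : P → P →ₗ[S] S), ∀ i, x i = ∑ a ∈ A, φ a (x i) • a := by
  classical
  obtain ⟨s, hs⟩ := Module.projective_def'.1 (inferInstance : Module.Projective S P)
  cases nonempty_fintype ι
  refine ⟨Finset.univ.biUnion fun i => (s (x i)).support, fun a => Finsupp.lapply a ∘ₗ s,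
    fun i => ?_⟩
  have hx : Finsupp.linearCombination S id (s (x i)) = x i := LinearMap.congr_fun hs (x i)
  rw [Finsupp.linearCombination_apply, Finsupp.sum_of_support_subset _
    (Finset.subset_biUnion_of_mem (fun i => (s (x i)).support) (Finset.mem_univ i)) _
    (by simp)] at hx
  exact hx.symm

theorem exists_le_of_fg_of_directed [Nonempty ι] {N : ι → Submodule S P} (hN : Directed (· ≤ ·) N)
    {L : Submodule S P} (hL : L.FG) (hle : L ≤ ⨆ i, N i) : ∃ i, L ≤ N i := by
  have hcompact := (Submodule.fg_iff_compact L).1 hL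
  rw [CompleteLattice.isCompactElement_iff_le_of_directed_sSup_le] at hcompact
  obtain ⟨_, ⟨i, rfl⟩, hi⟩ := hcompact (Set.range N) (Set.range_nonempty N)
    hN.directedOn_range (by rwa [sSup_range])
  exact ⟨i, hi⟩

end Module

section TensorAPI

open MulOpposite

variable {R : Type u} [Ring R] {M : Type v} [AddCommGroup M] [Module Rᵐᵒᵖ M]
  {Q : Type w} [AddCommGroup Q] [Module R Q]

variable (R) in
/-- The element `m ⊗ q` of `M ⊗_R Q`. -/
def tmul (m : M) (q : Q) : Tensor R M Q :=
  QuotientAddGroup.mk (m ⊗ₜ[ℤ] q)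

theorem add_tmul (m m' : M) (q : Q) : tmul R (m + m') q = tmul R m q + tmul R m' q := by
  simp only [tmul, TensorProduct.add_tmul, QuotientAddGroup.mk_add]

theorem tmul_add (m : M) (q q' : Q) : tmul R m (q + q') = tmul R m q + tmul R m q' := by
  simp only [tmul, TensorProduct.tmul_add, QuotientAddGroup.mk_add]

theorem smul_tmul (r : R) (m : M) (q : Q) : tmul R (op r • m) q = tmul R m (r • q) := by
  rw [tmul, tmul, ← sub_eq_zero, ← QuotientAddGroup.mk_sub, QuotientAddGroup.eq_zero_iff]
  exact AddSubgroup.subset_closure ⟨m, r, q, rfl⟩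

variable (R M Q) in
/-- The universal balanced biadditive map `M → Q → M ⊗_R Q`, used to transfer the identities of
additive maps to `tmul` and to build maps out of `M ⊗_R Q`. -/
def tmulHom : M →+ Q →+ Tensor R M Q :=
  AddMonoidHom.mk' (fun m => AddMonoidHom.mk' (tmul R m) (tmul_add m)) fun m m' =>
    AddMonoidHom.ext fun q => add_tmul m m' q

@[simp] theorem tmulHom_apply (m : M) (q : Q) : tmulHom R M Q m q = tmul R m q := rfl

@[simp] theorem tmul_zero (m : M) : tmul R m (0 : Q) = 0 := (tmulHom R M Q m).map_zero

@[simp] theorem zero_tmul (q : Q) : tmul R (0 : M) q = 0 := by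
  rw [← tmulHom_apply, map_zero, AddMonoidHom.zero_apply]

theorem sum_tmul {ι : Type*} (s : Finset ι) (m : ι → M) (q : Q) :
    tmul R (∑ i ∈ s, m i) q = ∑ i ∈ s, tmul R (m i) q := by
  simp only [← tmulHom_apply, map_sum, AddMonoidHom.finsetSum_apply]

theorem tmul_sum {ι : Type*} (s : Finset ι) (m : M) (q : ι → Q) :
    tmul R m (∑ i ∈ s, q i) = ∑ i ∈ s, tmul R m (q i) := by
  simp only [← tmulHom_apply, map_sum]

namespace Tensor

theorem exists_sum_tmul_eq (t : Tensor R M Q) :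
    ∃ (n : ℕ) (m : Fin n → M) (q : Fin n → Q), t = ∑ i, tmul R (m i) (q i) := by
  obtain ⟨t, rfl⟩ := QuotientAddGroup.mk_surjective t
  obtain ⟨n, m, q, rfl⟩ := TensorProduct.exists_sum_tmul_eq t
  exact ⟨n, m, q, map_sum (QuotientAddGroup.mk' (balancedRel R M Q)) _ _⟩

theorem addHom_ext {A : Type*} [AddCommGroup A] {α β : Tensor R M Q →+ A}
    (h : ∀ m q, α (tmul R m q) = β (tmul R m q)) : α = β := by
  refine DFunLike.ext _ _ fun t => ?_
  obtain ⟨n, m, q, rfl⟩ := t.exists_sum_tmul_eq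
  simp only [map_sum, h]

/-- The additive map on `M ⊗_R Q` induced by a balanced biadditive map. -/
def lift {A : Type*} [AddCommGroup A] (φ : M →+ Q →+ A)
    (hφ : ∀ (r : R) m q, φ (op r • m) q = φ m (r • q)) : Tensor R M Q →+ A :=
  QuotientAddGroup.lift _ (TensorProduct.liftAddHom (R := ℤ) φ (by simp)) (by
    rw [balancedRel, AddSubgroup.closure_le]
    rintro _ ⟨m, r, q, rfl⟩
    simp [hφ])

@[simp] theorem lift_tmul {A : Type*} [AddCommGroup A] (φ : M →+ Q →+ A)
    (hφ : ∀ (r : R) m q, φ (op r • m) q = φ m (r • q)) (m : M) (q : Q) :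
    lift φ hφ (tmul R m q) = φ m q := by
  simp [lift, tmul]

variable {Q' : Type*} [AddCommGroup Q'] [Module R Q'] {Q'' : Type*} [AddCommGroup Q'']
  [Module R Q'']

@[simp] theorem map_tmul (f : Q →ₗ[R] Q') (m : M) (q : Q) :
    map M f (tmul R m q) = tmul R m (f q) := rfl

theorem map_map (f : Q →ₗ[R] Q') (f' : Q' →ₗ[R] Q'') (t : Tensor R M Q) :
    map M f' (map M f t) = map M (f' ∘ₗ f) t :=
  DFunLike.congr_fun (addHom_ext (α := (map M f').comp (map M f))
    (β := map M (f' ∘ₗ f)) fun _ _ => rfl) t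

theorem map_injective_of_leftInverse {f : Q →ₗ[R] Q'} {g : Q' →ₗ[R] Q}
    (h : g ∘ₗ f = LinearMap.id) : Function.Injective (map M f) :=
  Function.LeftInverse.injective (g := map M g) fun t => by
    rw [map_map, h]
    exact DFunLike.congr_fun (addHom_ext (α := map M LinearMap.id)
      (β := AddMonoidHom.id _) fun _ _ => rfl) t

theorem map_surjective {f : Q →ₗ[R] Q'} (hf : Function.Surjective f) :
    Function.Surjective (map M f) := by
  intro t
  obtain ⟨n, m, q, rfl⟩ := t.exists_sum_tmul_eq
  choose p hp using fun i => hf (q i)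
  exact ⟨∑ i, tmul R (m i) (p i), by simp only [map_sum, map_tmul, hp]⟩

theorem exact_map {f : Q →ₗ[R] Q'} {g : Q' →ₗ[R] Q''} (hfg : Function.Exact f g)
    (hg : Function.Surjective g) : Function.Exact (map M f) (map M g) := by
  let F := LinearMap.lTensor M f.toAddMonoidHom.toIntLinearMap
  let G := LinearMap.lTensor M g.toAddMonoidHom.toIntLinearMap
  have hrel : balancedRel R M Q'' ≤ (balancedRel R M Q').map G.toAddMonoidHom := by
    rw [balancedRel, AddSubgroup.closure_le]
    rintro _ ⟨m, r, q, rfl⟩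
    obtain ⟨p, rfl⟩ := hg q
    exact ⟨_, AddSubgroup.subset_closure ⟨m, r, p, rfl⟩, by simp [G]⟩
  intro t
  constructor
  · obtain ⟨x, rfl⟩ := QuotientAddGroup.mk_surjective t
    intro hx
    obtain ⟨b, hb, hbx⟩ := hrel ((QuotientAddGroup.eq_zero_iff (G x)).1 hx)
    have hker : G (x - b) = 0 := by
      rw [map_sub, sub_eq_zero]
      exact hbx.symm
    have hfgℤ : Function.Exact f.toAddMonoidHom.toIntLinearMap g.toAddMonoidHom.toIntLinearMap :=
      hfg
    obtain ⟨y, hy⟩ := (lTensor_exact M hfgℤ hg _).1 hker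
    refine ⟨QuotientAddGroup.mk y, ?_⟩
    change QuotientAddGroup.mk (F y) = _
    rw [show F y = x - b from hy, QuotientAddGroup.mk_sub, (QuotientAddGroup.eq_zero_iff b).2 hb,
      sub_zero]
  · rintro ⟨s, rfl⟩
    obtain ⟨n, m, q, rfl⟩ := s.exists_sum_tmul_eq
    simp only [map_sum, map_tmul, hfg.apply_apply_eq_zero, tmul_zero, Finset.sum_const_zero]

theorem exists_sum_tmul_ker_of_map_eq_zero {f : Q →ₗ[R] Q'} (hf : Function.Surjective f)
    {t : Tensor R M Q} (ht : map M f t = 0) :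
    ∃ (n : ℕ) (m : Fin n → M) (q : Fin n → Q), (∀ i, f (q i) = 0) ∧
      t = ∑ i, tmul R (m i) (q i) := by
  obtain ⟨s, rfl⟩ := (exact_map f.exact_subtype_ker_map hf t).1 ht
  obtain ⟨n, m, q, rfl⟩ := s.exists_sum_tmul_eq
  exact ⟨n, m, fun i => q i, fun i => (q i).2, by simp only [map_sum, map_tmul]; rfl⟩

variable {M' : Type*} [AddCommGroup M'] [Module Rᵐᵒᵖ M'] {M'' : Type*} [AddCommGroup M'']
  [Module Rᵐᵒᵖ M'']

variable (Q) in
/-- The map `f ⊗_R Q : M ⊗_R Q → M' ⊗_R Q`, the counterpart of `Tensor.map` for the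
first factor. -/
def mapLeft (f : M →ₗ[Rᵐᵒᵖ] M') : Tensor R M Q →+ Tensor R M' Q :=
  lift ((tmulHom R M' Q).comp f.toAddMonoidHom) fun r m q => by simp [smul_tmul]

@[simp] theorem mapLeft_tmul (f : M →ₗ[Rᵐᵒᵖ] M') (m : M) (q : Q) :
    mapLeft Q f (tmul R m q) = tmul R (f m) q :=
  lift_tmul _ _ m q

theorem mapLeft_mapLeft (f : M →ₗ[Rᵐᵒᵖ] M') (f' : M' →ₗ[Rᵐᵒᵖ] M'') (t : Tensor R M Q) :
    mapLeft Q f' (mapLeft Q f t) = mapLeft Q (f' ∘ₗ f) t :=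
  DFunLike.congr_fun (addHom_ext (α := (mapLeft Q f').comp (mapLeft Q f)) fun m q => by simp) t

theorem map_mapLeft (f : M →ₗ[Rᵐᵒᵖ] M') (g : Q →ₗ[R] Q') (t : Tensor R M Q) :
    map M' g (mapLeft Q f t) = mapLeft Q' f (map M g t) :=
  DFunLike.congr_fun (addHom_ext (α := (map M' g).comp (mapLeft Q f))
    (β := (mapLeft Q' f).comp (map M g)) fun m q => by simp) t

section Contraction

variable (Q) in
/-- The contraction `M ⊗_R Q → Q`, `m ⊗ q ↦ φ(m) q`, along a functional on the right module `M`. -/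
def contractLeft (φ : M →ₗ[Rᵐᵒᵖ] Rᵐᵒᵖ) : Tensor R M Q →+ Q :=
  lift ((smulAddHom R Q).comp (opAddEquiv.symm.toAddMonoidHom.comp φ.toAddMonoidHom))
    fun r m q => by simp [mul_smul]

@[simp] theorem contractLeft_tmul (φ : M →ₗ[Rᵐᵒᵖ] Rᵐᵒᵖ) (m : M) (q : Q) :
    contractLeft Q φ (tmul R m q) = unop (φ m) • q :=
  lift_tmul _ _ m q

variable (M) in
/-- The contraction `M ⊗_R Q → M`, `m ⊗ q ↦ m ψ(q)`, along a functional on the left module `Q`. -/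
def contractRight (ψ : Q →ₗ[R] R) : Tensor R M Q →+ M :=
  lift ((smulAddHom Rᵐᵒᵖ M).comp (opAddEquiv.toAddMonoidHom.comp ψ.toAddMonoidHom)).flip
    fun r m q => by simp [mul_smul]

@[simp] theorem contractRight_tmul (ψ : Q →ₗ[R] R) (m : M) (q : Q) :
    contractRight M ψ (tmul R m q) = op (ψ q) • m :=
  lift_tmul _ _ m q

theorem contractLeft_map (φ : M →ₗ[Rᵐᵒᵖ] Rᵐᵒᵖ) (f : Q →ₗ[R] Q') (t : Tensor R M Q) :
    contractLeft Q' φ (map M f t) = f (contractLeft Q φ t) :=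
  DFunLike.congr_fun (addHom_ext (α := (contractLeft Q' φ).comp (map M f))
    (β := f.toAddMonoidHom.comp (contractLeft Q φ)) fun m q => by simp) t

theorem contractRight_mapLeft (ψ : Q →ₗ[R] R) (f : M →ₗ[Rᵐᵒᵖ] M') (t : Tensor R M Q) :
    contractRight M' ψ (mapLeft Q f t) = f (contractRight M ψ t) :=
  DFunLike.congr_fun (addHom_ext (α := (contractRight M' ψ).comp (mapLeft Q f))
    (β := f.toAddMonoidHom.comp (contractRight M ψ)) fun m q => by simp) t

theorem eq_zero_of_contractLeft_eq_zero [Module.Projective Rᵐᵒᵖ M] {t : Tensor R M Q}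
    (ht : ∀ φ, contractLeft Q φ t = 0) : t = 0 := by
  obtain ⟨n, m, q, rfl⟩ := t.exists_sum_tmul_eq
  obtain ⟨A, φ, hφ⟩ := exists_dual_basis_on (S := Rᵐᵒᵖ) m
  calc ∑ i, tmul R (m i) (q i) = ∑ i, ∑ a ∈ A, tmul R a (unop (φ a (m i)) • q i) := by
        refine Finset.sum_congr rfl fun i _ => ?_
        conv_lhs => rw [hφ i, sum_tmul]
        simp only [← smul_tmul, op_unop]
    _ = ∑ a ∈ A, tmul R a (contractLeft Q (φ a) (∑ i, tmul R (m i) (q i))) := by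
        rw [Finset.sum_comm]
        simp only [map_sum, contractLeft_tmul, tmul_sum]
    _ = 0 := by simp only [ht, tmul_zero, Finset.sum_const_zero]

theorem eq_zero_of_contractRight_eq_zero [Module.Projective R Q] {t : Tensor R M Q}
    (ht : ∀ ψ, contractRight M ψ t = 0) : t = 0 := by
  obtain ⟨n, m, q, rfl⟩ := t.exists_sum_tmul_eq
  obtain ⟨A, ψ, hψ⟩ := exists_dual_basis_on (S := R) q
  calc ∑ i, tmul R (m i) (q i) = ∑ i, ∑ a ∈ A, tmul R (op (ψ a (q i)) • m i) a := by
        refine Finset.sum_congr rfl fun i _ => ?_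
        conv_lhs => rw [hψ i, tmul_sum]
        simp only [smul_tmul]
    _ = ∑ a ∈ A, tmul R (contractRight M (ψ a) (∑ i, tmul R (m i) (q i))) a := by
        rw [Finset.sum_comm]
        simp only [map_sum, contractRight_tmul, sum_tmul]
    _ = 0 := by simp only [ht, zero_tmul, Finset.sum_const_zero]

theorem mapLeft_injective_of_projective [Module.Projective R Q] {f : M →ₗ[Rᵐᵒᵖ] M'}
    (hf : Function.Injective f) : Function.Injective (mapLeft (R := R) Q f) := by
  rw [injective_iff_map_eq_zero]
  intro t ht
  refine eq_zero_of_contractRight_eq_zero fun ψ => hf ?_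
  rw [← contractRight_mapLeft, ht, map_zero, map_zero]

end Contraction

end Tensor

end TensorAPI

section DirectedUnion

variable {R : Type u} [Ring R] {M : Type v} [AddCommGroup M] [Module Rᵐᵒᵖ M]
  {Q : Type w} [AddCommGroup Q] [Module R Q]

namespace Tensor

theorem exists_fg_mapLeft_subtype_eq (t : Tensor R M Q) :
    ∃ L : Submodule Rᵐᵒᵖ M, L.FG ∧ ∀ N, L ≤ N → ∃ s, mapLeft Q N.subtype s = t := by
  obtain ⟨n, m, q, rfl⟩ := t.exists_sum_tmul_eq
  refine ⟨Submodule.span Rᵐᵒᵖ (Set.range m), Submodule.fg_span (Set.finite_range m),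
    fun N hN => ?_⟩
  exact ⟨∑ i, tmul R ⟨m i, hN (Submodule.subset_span ⟨i, rfl⟩)⟩ (q i), by simp⟩

/-- A lift of `t` to a free left module becomes a finite sum `∑ y_i ⊗ k_i` of relations `k_i` over
`K`. Tensoring with a free module is injective on submodules, so this identity holds over every
submodule containing the `y_i`. -/
theorem exists_fg_forall_mapLeft_inclusion_eq_zero {N₀ K : Submodule Rᵐᵒᵖ M} (hK : N₀ ≤ K)
    {t : Tensor R N₀ Q} (ht : mapLeft Q (Submodule.inclusion hK) t = 0) :
    ∃ L ≤ K, L.FG ∧ ∀ N (hN : N₀ ≤ N), L ≤ N → mapLeft Q (Submodule.inclusion hN) t = 0 := by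
  let π : (Q →₀ R) →ₗ[R] Q := Finsupp.linearCombination R _root_.id
  have hπ : Function.Surjective π := Finsupp.linearCombination_id_surjective R Q
  obtain ⟨s, rfl⟩ := map_surjective hπ t
  rw [← map_mapLeft] at ht
  obtain ⟨n, y, k, hk, hs⟩ := exists_sum_tmul_ker_of_map_eq_zero hπ ht
  refine ⟨Submodule.span Rᵐᵒᵖ (Set.range fun i => (y i : M)), ?_,
    Submodule.fg_span (Set.finite_range _), fun N hN hL => ?_⟩
  · rw [Submodule.span_le]
    rintro _ ⟨i, rfl⟩
    exact (y i).2
  have hyN : ∀ i, (y i : M) ∈ N := fun i => hL (Submodule.subset_span ⟨i, rfl⟩)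
  have hsN : mapLeft _ (Submodule.inclusion hN) s = ∑ i, tmul R (⟨y i, hyN i⟩ : N) (k i) := by
    apply mapLeft_injective_of_projective N.injective_subtype
    have hsM := congrArg (mapLeft _ K.subtype) hs
    simp only [mapLeft_mapLeft, Submodule.subtype_comp_inclusion, map_sum, mapLeft_tmul,
      Submodule.subtype_apply] at hsM ⊢
    exact hsM
  simp only [← map_mapLeft, hsN, map_sum, map_tmul, hk, tmul_zero, Finset.sum_const_zero]

theorem exists_le_mapLeft_inclusion_eq_zero {C : Set (Submodule Rᵐᵒᵖ M)}
    (hdir : DirectedOn (· ≤ ·) C) (hcover : ∀ L : Submodule Rᵐᵒᵖ M, L.FG → ∃ N ∈ C, L ≤ N)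
    {N₀ N : Submodule Rᵐᵒᵖ M} (hN : N ∈ C)
    (hle : N₀ ≤ N) {t : Tensor R N₀ Q} (ht : mapLeft Q N₀.subtype t = 0) :
    ∃ N' ∈ C, ∃ h : N ≤ N', mapLeft Q (Submodule.inclusion (hle.trans h)) t = 0 := by
  have htop : mapLeft Q (Submodule.inclusion (le_top : N₀ ≤ ⊤)) t = 0 := by
    change mapLeft Q (Submodule.topEquiv.symm.toLinearMap ∘ₗ N₀.subtype) t = 0
    rw [← mapLeft_mapLeft, ht, map_zero]
  obtain ⟨L, -, hL, hzero⟩ := exists_fg_forall_mapLeft_inclusion_eq_zero le_top htop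
  obtain ⟨N₁, hN₁, hL₁⟩ := hcover L hL
  obtain ⟨N', hN', hNN', hN₁N'⟩ := hdir N hN N₁ hN₁
  exact ⟨N', hN', hNN', hzero _ _ (hL₁.trans hN₁N')⟩

end Tensor

end DirectedUnion

section FlatMittagLeffler

variable (R : Type u) [Ring R] (M : Type v) [AddCommGroup M] [Module Rᵐᵒᵖ M]

/-- `M ⊗_R -` preserves jointly injective families of maps (in the universe `w`). Flatness is the
case of a single map, the Mittag-Leffler property that of the projections of a product. -/
def IsFlatMittagLeffler : Prop :=
  ∀ (I P : Type w) (Q : I → Type w) [AddCommGroup P] [Module R P] [∀ i, AddCommGroup (Q i)]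
    [∀ i, Module R (Q i)] (f : ∀ i, P →ₗ[R] Q i), ⨅ i, LinearMap.ker (f i) = ⊥ →
    ∀ t : Tensor R M P, (∀ i, Tensor.map M (f i) t = 0) → t = 0

theorem isFlatMittagLeffler_iff :
    IsFlatMittagLeffler.{u, v, w} R M ↔ IsFlat.{u, v, w} R M ∧ IsMittagLeffler.{u, v, w} R M := by
  refine ⟨fun h => ⟨fun N P _ _ _ _ f hf => ?_, fun I Q _ _ => ?_⟩,
    fun ⟨hflat, hML⟩ I P Q _ _ _ _ f hf t ht => ?_⟩
  · refine (injective_iff_map_eq_zero _).2 fun t ht =>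
      h PUnit N (fun _ => P) (fun _ => f) ?_ t fun _ => ht
    rw [iInf_const, LinearMap.ker_eq_bot.2 hf]
  · exact (injective_iff_map_eq_zero _).2 fun t ht =>
      h I (∀ i, Q i) Q LinearMap.proj LinearMap.iInf_ker_proj t fun i => congrFun ht i
  · have hpi : Function.Injective (LinearMap.pi f) := by
      rw [← LinearMap.ker_eq_bot, LinearMap.ker_pi, hf]
    refine (injective_iff_map_eq_zero _).1 (hflat _ _ _ hpi) t
      ((injective_iff_map_eq_zero _).1 (hML I Q) _ (funext fun i => ?_))
    exact (Tensor.map_map _ _ _).trans (ht i)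

theorem isFlatMittagLeffler_of_projective [Module.Projective Rᵐᵒᵖ M] :
    IsFlatMittagLeffler.{u, v, w} R M := by
  intro I P Q _ _ _ _ f hf t ht
  refine Tensor.eq_zero_of_contractLeft_eq_zero fun φ => (Submodule.mem_bot R).1 ?_
  rw [← hf, Submodule.mem_iInf]
  intro i
  rw [LinearMap.mem_ker, ← Tensor.contractLeft_map, ht i, map_zero]

variable {R M}

namespace IsFlatMittagLeffler

theorem lower_universe (h : IsFlatMittagLeffler.{u, v, max w w'} R M) :
    IsFlatMittagLeffler.{u, v, w} R M := by
  intro I P Q _ _ _ _ f hf t ht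
  let up (P : Type w) [AddCommGroup P] [Module R P] : P ≃ₗ[R] ULift.{w'} P :=
    ULift.moduleEquiv.symm
  have hup : Function.Injective (Tensor.map M (up P).toLinearMap) :=
    Tensor.map_injective_of_leftInverse (g := (up P).symm) (LinearEquiv.symm_comp (up P))
  refine (injective_iff_map_eq_zero _).1 hup t (h (ULift I) _ (fun i => ULift (Q i.down))
    (fun i => up (Q i.down) ∘ₗ f i.down ∘ₗ (up P).symm) ?_ _ fun i => ?_)
  · rw [eq_bot_iff]
    rintro ⟨x⟩ hx
    have hx' : x ∈ ⨅ i, LinearMap.ker (f i) := by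
      simp only [Submodule.mem_iInf, LinearMap.mem_ker] at hx ⊢
      exact fun i => congrArg ULift.down (hx ⟨i⟩)
    rw [hf, Submodule.mem_bot] at hx'
    rw [hx']
    rfl
  · rw [Tensor.map_map]
    change Tensor.map M ((up (Q i.down)).toLinearMap ∘ₗ f i.down) t = 0
    rw [← Tensor.map_map, ht, map_zero]

theorem map_mkQ_iInf_ker_eq_zero (h : IsFlatMittagLeffler.{u, v, w} R M) {I P : Type w}
    {Q : I → Type w} [AddCommGroup P] [Module R P] [∀ i, AddCommGroup (Q i)]
    [∀ i, Module R (Q i)] (f : ∀ i, P →ₗ[R] Q i) {t : Tensor R M P}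
    (ht : ∀ i, Tensor.map M (f i) t = 0) :
    Tensor.map M (⨅ i, LinearMap.ker (f i)).mkQ t = 0 := by
  refine h I _ Q (fun i => Submodule.liftQ _ (f i) (iInf_le _ i)) ?_ _ fun i => ?_
  · rw [eq_bot_iff]
    intro x hx
    obtain ⟨x, rfl⟩ := Submodule.mkQ_surjective _ x
    simp only [Submodule.mem_iInf, LinearMap.mem_ker, Submodule.mkQ_apply,
      Submodule.liftQ_apply] at hx
    simpa only [Submodule.mem_bot, Submodule.mkQ_apply, Submodule.Quotient.mk_eq_zero,
      Submodule.mem_iInf, LinearMap.mem_ker] using hx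
  · rw [Tensor.map_map, Submodule.liftQ_mkQ, ht i]

/-- Dividing `P` by `⨅ k, ker (f k)` turns the hypothesis into the vanishing of a single tensor,
which therefore already happens at a finite stage. -/
theorem exists_mapLeft_map_eq_zero_of_iSup {N : ℕ → Submodule Rᵐᵒᵖ M} (hN : Monotone N)
    (h : IsFlatMittagLeffler.{u, v, w} R (⨆ k, N k : Submodule Rᵐᵒᵖ M)) {P : Type w}
    {Q : ℕ → Type w} [AddCommGroup P] [Module R P] [∀ k, AddCommGroup (Q k)]
    [∀ k, Module R (Q k)] (f : ∀ k, P →ₗ[R] Q k) (t : Tensor R (N 0) P)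
    (ht : ∀ k, Tensor.mapLeft (Q k) (Submodule.inclusion (hN (Nat.zero_le (k + 1))))
      (Tensor.map (N 0) (f k) t) = 0) :
    ∃ k, Tensor.mapLeft (Q k) (Submodule.inclusion (hN (Nat.zero_le k)))
      (Tensor.map (N 0) (f k) t) = 0 := by
  let K : Submodule R P := ⨅ k : ULift.{w} ℕ, LinearMap.ker (f k.down)
  have hK : Tensor.mapLeft (P ⧸ K) (Submodule.inclusion (le_iSup N 0))
      (Tensor.map (N 0) K.mkQ t) = 0 := by
    rw [← Tensor.map_mapLeft]
    refine h.map_mkQ_iInf_ker_eq_zero (fun k : ULift.{w} ℕ => f k.down) fun ⟨k⟩ => ?_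
    have hk := congrArg (Tensor.mapLeft (Q k) (Submodule.inclusion (le_iSup N (k + 1)))) (ht k)
    rw [Tensor.mapLeft_mapLeft, map_zero] at hk
    rw [Tensor.map_mapLeft]
    exact hk
  obtain ⟨L, hle, hL, hzero⟩ := Tensor.exists_fg_forall_mapLeft_inclusion_eq_zero _ hK
  obtain ⟨k, hk⟩ := exists_le_of_fg_of_directed hN.directed_le hL hle
  refine ⟨k, ?_⟩
  have hfk : f k = K.liftQ (f k) (iInf_le _ (ULift.up k)) ∘ₗ K.mkQ :=
    (Submodule.liftQ_mkQ K _ _).symm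
  rw [hfk, ← Tensor.map_map, ← Tensor.map_mapLeft, hzero _ _ hk, map_zero]

theorem of_directedOn {C : Set (Submodule Rᵐᵒᵖ M)} (hdir : DirectedOn (· ≤ ·) C)
    (hcover : ∀ L : Submodule Rᵐᵒᵖ M, L.FG → ∃ N ∈ C, L ≤ N)
    (hchain : ∀ N : ℕ → Submodule Rᵐᵒᵖ M, Monotone N → (∀ k, N k ∈ C) → ⨆ k, N k ∈ C)
    (hC : ∀ N ∈ C, IsFlatMittagLeffler.{u, v, w} R N) : IsFlatMittagLeffler.{u, v, w} R M := by
  intro I P Q _ _ _ _ f hf t ht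
  obtain ⟨L, hL, hLt⟩ := Tensor.exists_fg_mapLeft_subtype_eq t
  obtain ⟨N₀, hN₀, hLN₀⟩ := hcover L hL
  obtain ⟨t₀, rfl⟩ := hLt N₀ hLN₀
  by_contra hne
  let Above := {N // N ∈ C ∧ N₀ ≤ N}
  have hstep (N : Above) : ∃ (i : I) (N' : Above), N ≤ N' ∧
      Tensor.mapLeft (Q i) (Submodule.inclusion N.2.2) (Tensor.map N₀ (f i) t₀) ≠ 0 ∧
      Tensor.mapLeft (Q i) (Submodule.inclusion N'.2.2) (Tensor.map N₀ (f i) t₀) = 0 := by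
    obtain ⟨N, hN, hle⟩ := N
    have hNt : Tensor.mapLeft P (Submodule.inclusion hle) t₀ ≠ 0 := fun h0 =>
      hne (by rw [← Submodule.subtype_comp_inclusion _ _ hle, ← Tensor.mapLeft_mapLeft, h0,
        map_zero])
    obtain ⟨i, hi⟩ := not_forall.1 fun h0 => hNt (hC N hN I P Q f hf _ h0)
    rw [Tensor.map_mapLeft] at hi
    have hfi := ht i
    rw [Tensor.map_mapLeft] at hfi
    obtain ⟨N', hN', hNN', hzero⟩ :=
      Tensor.exists_le_mapLeft_inclusion_eq_zero hdir hcover hN hle hfi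
    exact ⟨i, ⟨N', hN', hle.trans hNN'⟩, hNN', hi, hzero⟩
  choose i next hnext hi hzero using hstep
  let N (k : ℕ) : Above := next^[k] ⟨N₀, hN₀, le_rfl⟩
  have hsucc (k : ℕ) : N (k + 1) = next (N k) := Function.iterate_succ_apply' next k _
  have hN : Monotone fun k => (N k).1 :=
    monotone_nat_of_le_succ fun k => hsucc k ▸ hnext (N k)
  have hzeroN (k : ℕ) : Tensor.mapLeft (Q (i (N k))) (Submodule.inclusion (N (k + 1)).2.2)
      (Tensor.map N₀ (f (i (N k))) t₀) = 0 :=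
    (hsucc k).symm ▸ hzero (N k)
  obtain ⟨k, hk⟩ := (hC _ (hchain _ hN fun k => (N k).2.1)).exists_mapLeft_map_eq_zero_of_iSup hN
    (fun k => f (i (N k))) t₀ hzeroN
  exact hi (N k) hk

end IsFlatMittagLeffler

theorem IsKappaProjective.isFlatMittagLeffler {κ : Cardinal.{v}} (hκ : Cardinal.aleph0 < κ)
    (h : IsKappaProjective Rᵐᵒᵖ M κ) : IsFlatMittagLeffler.{u, v, w} R M := by
  obtain ⟨C, hC, hproj⟩ := h
  refine .of_directedOn hC.directed (fun L hL => ?_) (fun N hN hNC => ?_) fun N hN => ?_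
  · obtain ⟨X, rfl⟩ := hL
    obtain ⟨N, hN, hX⟩ := hC.cover X ((Cardinal.mk_lt_aleph0).trans hκ)
    exact ⟨N, hN, Submodule.span_le.2 hX⟩
  · have hmem := hC.chain (ULift.{v} ℕ) (by simpa using hκ) (fun k => N k.down)
      (fun _ _ hkl => hN hkl) fun k => hNC k.down
    rwa [iSup_ulift] at hmem
  · have := (hproj N hN).2
    exact isFlatMittagLeffler_of_projective R N

end FlatMittagLeffler

section StableFactorization

open LinearMap

variable {S : Type u} [Ring S] {M : Type v} [AddCommGroup M] [Module S M]
  {F : Type u} [AddCommGroup F] [Module S F] {G : Type u} [AddCommGroup G] [Module S G]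

/-- The factorization `f = g ∘ u` has the same kernel as `f`, and `u` factors through the first
map of every factorization of `f` through a finitely generated free module. These are the
stabilizers of Raynaud and Gruson. -/
structure IsStableFactorization (f : F →ₗ[S] M) (u : F →ₗ[S] G) (g : G →ₗ[S] M) : Prop where
  comp : g ∘ₗ u = f
  ker_le : ker f ≤ ker u
  dominating : ∀ (H : Type u) [AddCommGroup H] [Module S H] [Module.Free S H] [Module.Finite S H]
    (v : F →ₗ[S] H) (k : H →ₗ[S] M), k ∘ₗ v = f → ∃ B : H →ₗ[S] G, B ∘ₗ v = u

/-- Every map from a finitely generated free module to `N` has a stable factorization, as a map to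
`M`, through a finitely generated free module whose image lies in `N'`. The case `N = N' = ⊤`
is a property of the module `M`. -/
def HasStableFactorizations (N N' : Submodule S M) : Prop :=
  ∀ (F : Type u) [AddCommGroup F] [Module S F] [Module.Free S F] [Module.Finite S F]
    (f : F →ₗ[S] M), range f ≤ N → ∃ (n : ℕ) (u : F →ₗ[S] (Fin n → S))
      (g : (Fin n → S) →ₗ[S] M), range g ≤ N' ∧ IsStableFactorization f u g

namespace IsStableFactorization

theorem postcomp {f : F →ₗ[S] M} {u : F →ₗ[S] G} {g : G →ₗ[S] M}
    (h : IsStableFactorization f u g) {G' : Type u} [AddCommGroup G'] [Module S G']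
    {i : G →ₗ[S] G'} {g' : G' →ₗ[S] M} (hi : g' ∘ₗ i = g) :
    IsStableFactorization f (i ∘ₗ u) g' where
  comp := by rw [← LinearMap.comp_assoc, hi, h.comp]
  ker_le := h.ker_le.trans (ker_le_ker_comp u i)
  dominating H _ _ _ _ v k hk := by
    obtain ⟨B, rfl⟩ := h.dominating H v k hk
    exact ⟨i ∘ₗ B, rfl⟩

/-- Given another factorization `f ∘ b = k ∘ v`, a stable factorization of `f.coprod k` identifies
`b c` with `v c` for every `c`, since their difference is in the kernel. -/
theorem precomp [Module.Free S F] [Module.Finite S F]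
    (hM : HasStableFactorizations (⊤ : Submodule S M) ⊤) {f : F →ₗ[S] M} {u : F →ₗ[S] G}
    {g : G →ₗ[S] M} (h : IsStableFactorization f u g) {E : Type u} [AddCommGroup E] [Module S E]
    (b : E →ₗ[S] F) : IsStableFactorization (f ∘ₗ b) (u ∘ₗ b) g where
  comp := by rw [← LinearMap.comp_assoc, h.comp]
  ker_le _ hc := h.ker_le hc
  dominating H _ _ _ _ v k hk := by
    obtain ⟨n, w, l, -, hw⟩ := hM (F × H) (f.coprod k) le_top
    obtain ⟨B, hB⟩ := h.dominating _ (w ∘ₗ inl S F H) l (by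
      rw [← LinearMap.comp_assoc, hw.comp, coprod_inl])
    have hglue : w ∘ₗ inl S F H ∘ₗ b = w ∘ₗ inr S F H ∘ₗ v := by
      ext1 c
      have hker : inl S F H (b c) - inr S F H (v c) ∈ ker (f.coprod k) := by
        have hc : k (v c) = f (b c) := LinearMap.congr_fun hk c
        simp [hc]
      exact sub_eq_zero.1 ((map_sub w _ _).symm.trans (hw.ker_le hker))
    exact ⟨B ∘ₗ w ∘ₗ inr S F H, by
      rw [← hB, LinearMap.comp_assoc, LinearMap.comp_assoc, ← hglue]; rfl⟩

/-- The lift `l₀` of `k` is corrected by its deviation `l₀ ∘ v - l` from `l`, transported along the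
retraction `B` of `v` on the image of `u`. -/
theorem exists_compatible_lift {f : F →ₗ[S] M} {u : F →ₗ[S] G} {g : G →ₗ[S] M}
    (h : IsStableFactorization f u g) {H : Type u} [AddCommGroup H] [Module S H] [Module.Free S H]
    [Module.Finite S H] {v : G →ₗ[S] H} {k : H →ₗ[S] M} (hk : k ∘ₗ v = g) {P : Type*}
    [AddCommGroup P] [Module S P] {p : P →ₗ[S] M} (hp : Function.Surjective p) {l : G →ₗ[S] P}
    (hl : p ∘ₗ l = g) : ∃ l' : H →ₗ[S] P, p ∘ₗ l' = k ∧ l' ∘ₗ v ∘ₗ u = l ∘ₗ u := by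
  obtain ⟨l₀, hl₀⟩ := Module.projective_lifting_property p k hp
  obtain ⟨B, hB⟩ := h.dominating H (v ∘ₗ u) k (by rw [← LinearMap.comp_assoc, hk, h.comp])
  refine ⟨l₀ - (l₀ ∘ₗ v - l) ∘ₗ B, ?_, ?_⟩
  · rw [comp_sub, ← LinearMap.comp_assoc B, comp_sub, ← LinearMap.comp_assoc, hl₀, hk, hl, sub_self,
      zero_comp, sub_zero]
  · rw [sub_comp, LinearMap.comp_assoc _ B, hB, sub_comp, LinearMap.comp_assoc, sub_sub_cancel]

end IsStableFactorization

theorem exists_linearCombination_comp_eq [Module.Projective S F] [Module.Finite S F]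
    (f : F →ₗ[S] M) {X : Set M} (hf : range f ≤ Submodule.span S X) :
    ∃ (n : ℕ) (x : Fin n → M) (b : F →ₗ[S] (Fin n → S)), (∀ i, x i ∈ X) ∧
      Fintype.linearCombination S x ∘ₗ b = f := by
  obtain ⟨t, ht⟩ := Submodule.fg_range f
  obtain ⟨s, hsX, hts⟩ := Submodule.subset_span_finite_of_subset_span (R := S) (s := X) (t := t)
    (Submodule.subset_span.trans (ht.le.trans hf))
  let x : Fin s.card → M := Subtype.val ∘ s.equivFin.symm
  have hfx (c : F) : f c ∈ range (Fintype.linearCombination S x) := by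
    rw [Fintype.range_linearCombination, Set.range_comp, Equiv.range_eq_univ, Set.image_univ,
      Subtype.range_coe]
    exact Submodule.span_le.2 hts (ht ▸ mem_range_self f c)
  obtain ⟨b, hb⟩ := Module.projective_lifting_property _ (f.codRestrict _ hfx)
    (Fintype.linearCombination S x).surjective_rangeRestrict
  exact ⟨s.card, x, b, fun i => hsX (s.equivFin.symm i).2,
    LinearMap.ext fun c => congrArg Subtype.val (LinearMap.congr_fun hb c)⟩

namespace HasStableFactorizations

theorem le {N N' : Submodule S M} (h : HasStableFactorizations N N') : N ≤ N' := by
  intro x hx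
  obtain ⟨n, u, g, hg, hu⟩ := h S (toSpanSingleton S M x) (by
    rwa [range_toSpanSingleton, Submodule.span_singleton_le_iff_mem])
  rw [← toSpanSingleton_apply_one S M x, ← hu.comp]
  exact hg ⟨u 1, rfl⟩

theorem iSup {ι : Type*} [Nonempty ι] {N N' : ι → Submodule S M} (hN : Directed (· ≤ ·) N)
    (h : ∀ i, HasStableFactorizations (N i) (N' i)) :
    HasStableFactorizations (⨆ i, N i) (⨆ i, N' i) := by
  intro F _ _ _ _ f hf
  obtain ⟨i, hi⟩ := exists_le_of_fg_of_directed hN (Submodule.fg_range f) hf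
  obtain ⟨n, u, g, hg, hu⟩ := h i F f hi
  exact ⟨n, u, g, hg.trans (le_iSup N' i), hu⟩

theorem top_of_submodule {N : Submodule S M} (h : HasStableFactorizations N N) :
    HasStableFactorizations (⊤ : Submodule S N) ⊤ := by
  intro F _ _ _ _ f _
  obtain ⟨n, u, g, hg, hu⟩ := h F (N.subtype ∘ₗ f) (by rintro _ ⟨c, rfl⟩; exact (f c).2)
  refine ⟨n, u, g.codRestrict N fun c => hg ⟨c, rfl⟩, le_top, ?_, ?_, fun H _ _ _ _ v k hk => ?_⟩
  · exact LinearMap.ext fun c => Subtype.ext (LinearMap.congr_fun hu.comp c)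
  · exact (ker_le_ker_comp f N.subtype).trans hu.ker_le
  · exact hu.dominating H v (N.subtype ∘ₗ k) (by rw [LinearMap.comp_assoc, hk])

end HasStableFactorizations

end StableFactorization

section CountablyGenerated

open LinearMap

variable {S : Type u} [Ring S] {M : Type v} [AddCommGroup M] [Module S M]

theorem exists_forall_comp_eq_of_directed {P : Type*} [AddCommGroup P] [Module S P] {ι : Type*}
    [Nonempty ι] {F : ι → Type*} [∀ i, AddCommGroup (F i)] [∀ i, Module S (F i)]
    (z : ∀ i, F i →ₗ[S] M) (h : ∀ i, F i →ₗ[S] P)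
    (hdir : Directed (· ≤ ·) fun i => range ((z i).prod (h i)))
    (hker : ∀ i, ker (z i) ≤ ker (h i)) (hsurj : ∀ x, ∃ i, x ∈ range (z i)) :
    ∃ s : M →ₗ[S] P, ∀ i, s ∘ₗ z i = h i := by
  let Γ : Submodule S (M × P) := ⨆ i, range ((z i).prod (h i))
  have hΓ (i) (c : F i) : (z i c, h i c) ∈ Γ :=
    le_iSup (fun i => range ((z i).prod (h i))) i ⟨c, rfl⟩
  have hinj : Function.Injective (fst S M P ∘ₗ Γ.subtype) := by
    rw [← ker_eq_bot, eq_bot_iff]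
    rintro ⟨x, hx⟩ hx0
    obtain ⟨i, c, rfl⟩ := (Submodule.mem_iSup_of_directed _ hdir).1 hx
    have hzc : z i c = 0 := hx0
    have hhc : h i c = 0 := hker i hzc
    simp [hzc, hhc]
  have hsurjΓ : Function.Surjective (fst S M P ∘ₗ Γ.subtype) := by
    intro x
    obtain ⟨i, c, rfl⟩ := hsurj x
    exact ⟨⟨_, hΓ i c⟩, rfl⟩
  obtain ⟨s, hs⟩ := Submodule.exists_eq_graph (G := Γ) ⟨hinj, hsurjΓ⟩
  refine ⟨s, fun i => LinearMap.ext fun c => ?_⟩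
  have hmem := hΓ i c
  rw [hs, mem_graph_iff] at hmem
  exact hmem.symm

variable (S M) in
/-- A sequence of finitely generated free modules over `M`, each mapped to the next by a stable
factorization, whose images exhaust `M`. It exhibits a countably generated module with stable
factorizations as a direct limit along which lifting problems can be solved one step at a time. -/
structure StableChain where
  rank : ℕ → ℕ
  map : ∀ k, (Fin (rank k) → S) →ₗ[S] M
  trans : ∀ k, (Fin (rank k) → S) →ₗ[S] (Fin (rank (k + 1)) → S)
  stable : ∀ k, IsStableFactorization (map k) (trans k) (map (k + 1))
  surj : ∀ x, ∃ k, x ∈ range (map k)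

theorem HasStableFactorizations.exists_mem_range
    (hM : HasStableFactorizations (⊤ : Submodule S M) ⊤) {n : ℕ} (f : (Fin n → S) →ₗ[S] M)
    (x : M) : ∃ (m : ℕ) (u : (Fin n → S) →ₗ[S] (Fin m → S)) (g : (Fin m → S) →ₗ[S] M),
      IsStableFactorization f u g ∧ x ∈ range g := by
  obtain ⟨m, u, g, -, h⟩ := hM _ f le_top
  let e := Fin.consLinearEquiv S (fun _ : Fin (m + 1) => S)
  let g' : (Fin (m + 1) → S) →ₗ[S] M := (toSpanSingleton S M x).coprod g ∘ₗ e.symm.toLinearMap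
  refine ⟨m + 1, (e.toLinearMap ∘ₗ inr S S (Fin m → S)) ∘ₗ u, g', h.postcomp ?_, e (1, 0), ?_⟩
  · ext c
    simp [g']
  · simp [g']

theorem HasStableFactorizations.nonempty_stableChain
    (hM : HasStableFactorizations (⊤ : Submodule S M) ⊤) {x : ℕ → M}
    (hx : Submodule.span S (Set.range x) = ⊤) : Nonempty (StableChain S M) := by
  let Stage := Σ n : ℕ, (Fin n → S) →ₗ[S] M
  have hstep (s : Stage) (y : M) : ∃ (s' : Stage) (u : (Fin s.1 → S) →ₗ[S] (Fin s'.1 → S)),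
      IsStableFactorization s.2 u s'.2 ∧ y ∈ range s'.2 := by
    obtain ⟨m, u, g, h, hy⟩ := hM.exists_mem_range s.2 y
    exact ⟨⟨m, g⟩, u, h, hy⟩
  choose next u hu hmem using hstep
  let s (k : ℕ) : Stage := Nat.rec ⟨0, 0⟩ (fun k s => next s (x k)) k
  have hstable (k : ℕ) : IsStableFactorization (s k).2 (u (s k) (x k)) (s (k + 1)).2 := hu _ _
  have hmono : Monotone fun k => range (s k).2 := monotone_nat_of_le_succ fun k => by
    rw [← (hstable k).comp]
    exact range_comp_le_range _ _
  refine ⟨⟨_, fun k => (s k).2, fun k => u (s k) (x k), hstable, fun y => ?_⟩⟩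
  rw [← Submodule.mem_iSup_of_directed _ hmono.directed_le]
  have hspan : Submodule.span S (Set.range x) ≤ ⨆ k, range (s k).2 := by
    rw [Submodule.span_le]
    rintro _ ⟨k, rfl⟩
    exact le_iSup (fun k => range (s k).2) (k + 1) (hmem _ _)
  exact hspan (hx ▸ Submodule.mem_top)

namespace StableChain

variable {P : Type*} [AddCommGroup P] [Module S P] {p : P →ₗ[S] M}

theorem exists_lifts (s : StableChain S M) (hp : Function.Surjective p) :
    ∃ l : ∀ k, (Fin (s.rank (k + 1)) → S) →ₗ[S] P, (∀ k, p ∘ₗ l k = s.map (k + 1)) ∧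
      ∀ k, l (k + 1) ∘ₗ s.trans (k + 1) ∘ₗ s.trans k = l k ∘ₗ s.trans k := by
  let Lift (k : ℕ) := {l : (Fin (s.rank (k + 1)) → S) →ₗ[S] P // p ∘ₗ l = s.map (k + 1)}
  have hstep (k : ℕ) (l : Lift k) : ∃ l' : Lift (k + 1),
      l'.1 ∘ₗ s.trans (k + 1) ∘ₗ s.trans k = l.1 ∘ₗ s.trans k := by
    obtain ⟨l', hl', hcomp⟩ :=
      (s.stable k).exists_compatible_lift (s.stable (k + 1)).comp hp l.2
    exact ⟨⟨l', hl'⟩, hcomp⟩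
  choose next hnext using hstep
  obtain ⟨l₀, hl₀⟩ := Module.projective_lifting_property p (s.map 1) hp
  let l (k : ℕ) : Lift k := Nat.rec ⟨l₀, hl₀⟩ next k
  exact ⟨fun k => (l k).1, fun k => (l k).2, fun k => hnext k (l k)⟩

theorem exists_rightInverse (s : StableChain S M) (hp : Function.Surjective p) :
    ∃ σ : M →ₗ[S] P, p ∘ₗ σ = LinearMap.id := by
  obtain ⟨l, hl, hcomp⟩ := s.exists_lifts hp
  have hmono : Monotone fun k => range ((s.map k).prod (l k ∘ₗ s.trans k)) := by
    refine monotone_nat_of_le_succ fun k => ?_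
    rw [← (s.stable k).comp, ← hcomp]
    exact range_comp_le_range (s.trans k) ((s.map (k + 1)).prod (l (k + 1) ∘ₗ s.trans (k + 1)))
  obtain ⟨σ, hσ⟩ := exists_forall_comp_eq_of_directed s.map _ hmono.directed_le
    (fun k => (s.stable k).ker_le.trans (ker_le_ker_comp _ _)) s.surj
  refine ⟨σ, LinearMap.ext fun x => ?_⟩
  obtain ⟨k, c, rfl⟩ := s.surj x
  calc p (σ (s.map k c)) = p (l k (s.trans k c)) := congrArg p (LinearMap.congr_fun (hσ k) c)
    _ = s.map (k + 1) (s.trans k c) := LinearMap.congr_fun (hl k) _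
    _ = s.map k c := LinearMap.congr_fun (s.stable k).comp c

end StableChain

theorem HasStableFactorizations.projective (hM : HasStableFactorizations (⊤ : Submodule S M) ⊤)
    {X : Set M} (hX : X.Countable) (hspan : Submodule.span S X = ⊤) : Module.Projective S M := by
  obtain ⟨x, hx⟩ := (hX.insert 0).exists_eq_range (Set.insert_nonempty 0 X)
  obtain ⟨s⟩ := hM.nonempty_stableChain (x := x) (by rw [← hx, Submodule.span_insert_zero, hspan])
  exact Module.projective_def'.2
    (s.exists_rightInverse (Finsupp.linearCombination_id_surjective S M))

end CountablyGenerated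

section AlephOne

open LinearMap Cardinal

variable {S : Type u} [Ring S] {M : Type v} [AddCommGroup M] [Module S M]

theorem isLTGenerated_aleph_one_iff {N : Submodule S M} :
    IsLTGenerated (ℵ_ 1) N ↔ ∃ X : Set M, X.Countable ∧ Submodule.span S X = N := by
  simp only [IsLTGenerated, lt_aleph_one_iff, le_aleph0_iff_set_countable]

theorem isLTGenerated_aleph_one_of_fg {N : Submodule S M} (hN : N.FG) :
    IsLTGenerated (ℵ_ 1) N := by
  obtain ⟨X, rfl⟩ := hN
  exact isLTGenerated_aleph_one_iff.2 ⟨X, X.countable_toSet, rfl⟩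

theorem isLTGenerated_aleph_one_iSup {ι : Type*} [Countable ι] {N : ι → Submodule S M}
    (hN : ∀ i, IsLTGenerated (ℵ_ 1) (N i)) : IsLTGenerated (ℵ_ 1) (⨆ i, N i) := by
  simp only [isLTGenerated_aleph_one_iff] at hN ⊢
  choose X hX hXN using hN
  exact ⟨⋃ i, X i, Set.countable_iUnion hX, by simp only [Submodule.span_iUnion, hXN]⟩

namespace HasStableFactorizations

theorem projective_of_isLTGenerated {N : Submodule S M} (hN : HasStableFactorizations N N)
    (hgen : IsLTGenerated (ℵ_ 1) N) : Module.Projective S N := by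
  obtain ⟨X, hX, rfl⟩ := isLTGenerated_aleph_one_iff.1 hgen
  exact hN.top_of_submodule.projective (hX.preimage Subtype.val_injective)
    (Submodule.span_span_coe_preimage (R := S) (s := X))

variable (hM : HasStableFactorizations (⊤ : Submodule S M) ⊤)
include hM

theorem exists_isLTGenerated {N : Submodule S M} (hN : IsLTGenerated (ℵ_ 1) N) :
    ∃ N', IsLTGenerated (ℵ_ 1) N' ∧ HasStableFactorizations N N' := by
  obtain ⟨X, hX, rfl⟩ := isLTGenerated_aleph_one_iff.1 hN
  have := hX.to_subtype
  choose m u g _ h using fun p : Σ n : ℕ, Fin n → X =>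
    hM _ (Fintype.linearCombination S fun i => (p.2 i : M)) le_top
  refine ⟨⨆ p, range (g p),
    isLTGenerated_aleph_one_iSup fun p => isLTGenerated_aleph_one_of_fg (Submodule.fg_range _), ?_⟩
  intro F _ _ _ _ f hf
  obtain ⟨n, x, b, hx, rfl⟩ := exists_linearCombination_comp_eq f hf
  let p : Σ n : ℕ, Fin n → X := ⟨n, fun i => ⟨x i, hx i⟩⟩
  exact ⟨m p, u p ∘ₗ b, g p, le_iSup (fun p => range (g p)) p, (h p).precomp hM b⟩

theorem exists_isLTGenerated_self {N : Submodule S M} (hN : IsLTGenerated (ℵ_ 1) N) :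
    ∃ N', N ≤ N' ∧ HasStableFactorizations N' N' ∧ IsLTGenerated (ℵ_ 1) N' := by
  choose next hnext hstable using fun N : {N : Submodule S M // IsLTGenerated (ℵ_ 1) N} =>
    hM.exists_isLTGenerated N.2
  let s (k : ℕ) : {N : Submodule S M // IsLTGenerated (ℵ_ 1) N} :=
    (fun N => ⟨next N, hnext N⟩)^[k] ⟨N, hN⟩
  have hsucc (k : ℕ) : HasStableFactorizations (s k).1 (s (k + 1)).1 := by
    simp only [s, Function.iterate_succ_apply']
    exact hstable _
  have hmono : Monotone fun k => (s k).1 := monotone_nat_of_le_succ fun k => (hsucc k).le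
  have hself := HasStableFactorizations.iSup hmono.directed_le hsucc
  rw [hmono.iSup_nat_add 1] at hself
  exact ⟨_, le_iSup (fun k => (s k).1) 0, hself, isLTGenerated_aleph_one_iSup fun k => (s k).2⟩

theorem isKappaProjective_aleph_one : IsKappaProjective S M (ℵ_ 1) := by
  refine ⟨{N | HasStableFactorizations N N ∧ IsLTGenerated (ℵ_ 1) N}, ⟨?_, ?_, ?_⟩,
    fun N hN => ⟨hN.2, hN.1.projective_of_isLTGenerated hN.2⟩⟩
  · intro N₁ hN₁ N₂ hN₂
    obtain ⟨N, hle, hN⟩ := hM.exists_isLTGenerated_self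
      (isLTGenerated_aleph_one_iSup (N := fun b => cond b N₁ N₂) (Bool.rec hN₂.2 hN₁.2))
    rw [← sup_eq_iSup] at hle
    exact ⟨N, hN, le_sup_left.trans hle, le_sup_right.trans hle⟩
  · intro ι _ _ _ hι N hN hmem
    have : Countable ι := mk_le_aleph0_iff.1 (lt_aleph_one_iff.1 hι)
    exact ⟨.iSup hN.directed_le fun i => (hmem i).1,
      isLTGenerated_aleph_one_iSup fun i => (hmem i).2⟩
  · intro X hX
    obtain ⟨N, hle, hN⟩ := hM.exists_isLTGenerated_self ⟨X, hX, rfl⟩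
    exact ⟨N, hN, Submodule.subset_span.trans hle⟩

end HasStableFactorizations

end AlephOne

section Content

open MulOpposite

variable {R : Type u} [Ring R] {M : Type v} [AddCommGroup M] [Module Rᵐᵒᵖ M]
  {ι : Type*} [Fintype ι] [DecidableEq ι]

variable (R) in
/-- The element `∑ j, m j ⊗ e j` of `M ⊗_R R^ι`, which encodes the tuple `m`. -/
def tupleTensor (m : ι → M) : Tensor R M (ι → R) :=
  ∑ j, tmul R (m j) (Pi.single j 1)

variable (R) in
/-- The Ohm–Rush content of the tuple `m`: the intersection of the left submodules `L` of `R^ι` for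
which `m` lies in the image of `M ⊗_R L`, that is, is a combination of elements of `L` with
coefficients in `M`. -/
def content (m : ι → M) : Submodule R (ι → R) :=
  sInf {L | Tensor.map M L.mkQ (tupleTensor R m) = 0}

variable {m : ι → M}

theorem map_tupleTensor {Q : Type*} [AddCommGroup Q] [Module R Q] (f : (ι → R) →ₗ[R] Q) :
    Tensor.map M f (tupleTensor R m) = ∑ j, tmul R (m j) (f (Pi.single j 1)) := by
  simp only [tupleTensor, map_sum, Tensor.map_tmul]

theorem tupleTensor_eq_sum_iff {κ : Type*} [Fintype κ] {y : κ → M} {a : κ → ι → R} :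
    tupleTensor R m = ∑ k, tmul R (y k) (a k) ↔ ∀ j, m j = ∑ k, op (a k j) • y k := by
  constructor
  · intro h j
    have hj := congrArg (Tensor.contractRight M (LinearMap.proj j)) h
    simpa [tupleTensor, Pi.single_apply, apply_ite op] using hj
  · intro h
    calc tupleTensor R m = ∑ j, ∑ k, tmul R (y k) (a k j • Pi.single j 1) := by
          simp only [tupleTensor, h, sum_tmul, smul_tmul]
      _ = ∑ k, tmul R (y k) (a k) := by
          rw [Finset.sum_comm]
          refine Finset.sum_congr rfl fun k _ => ?_
          rw [← tmul_sum]
          congr 1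
          exact (pi_eq_sum_univ' (a k)).symm

theorem content_le {L : Submodule R (ι → R)}
    (hL : Tensor.map M L.mkQ (tupleTensor R m) = 0) : content R m ≤ L :=
  sInf_le hL

theorem content_le_span {κ : Type*} [Fintype κ] {y : κ → M} {a : κ → ι → R}
    (h : ∀ j, m j = ∑ k, op (a k j) • y k) : content R m ≤ Submodule.span R (Set.range a) := by
  have ha (k : κ) : (Submodule.span R (Set.range a)).mkQ (a k) = 0 :=
    (Submodule.Quotient.mk_eq_zero _).2 (Submodule.subset_span ⟨k, rfl⟩)
  refine content_le ?_
  simp only [tupleTensor_eq_sum_iff.2 h, map_sum, Tensor.map_tmul, ha, tmul_zero,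
    Finset.sum_const_zero]

end Content

namespace IsFlatMittagLeffler

open MulOpposite

variable {R : Type u} [Ring R] {M : Type v} [AddCommGroup M] [Module Rᵐᵒᵖ M]
  (hM : IsFlatMittagLeffler.{u, v, u} R M) {ι : Type u} [Fintype ι] [DecidableEq ι] {m : ι → M}
include hM

theorem map_mkQ_content_eq_zero : Tensor.map M (content R m).mkQ (tupleTensor R m) = 0 := by
  have hcontent : content R m =
      ⨅ L : {L : Submodule R (ι → R) // Tensor.map M L.mkQ (tupleTensor R m) = 0},
        LinearMap.ker L.1.mkQ := by
    simp only [content, sInf_eq_iInf', Submodule.ker_mkQ]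
    rfl
  rw [hcontent]
  exact hM.map_mkQ_iInf_ker_eq_zero
    (I := {L : Submodule R (ι → R) // Tensor.map M L.mkQ (tupleTensor R m) = 0})
    (Q := fun L => (ι → R) ⧸ L.1) (fun L => L.1.mkQ) fun L => L.2

theorem exists_eq_sum_content (m : ι → M) :
    ∃ (n : ℕ) (y : Fin n → M) (a : Fin n → ι → R), (∀ k, a k ∈ content R m) ∧
      ∀ j, m j = ∑ k, op (a k j) • y k := by
  obtain ⟨n, y, a, ha, h⟩ := Tensor.exists_sum_tmul_ker_of_map_eq_zero
    (Submodule.mkQ_surjective _) (hM.map_mkQ_content_eq_zero (m := m))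
  exact ⟨n, y, a, fun k => (Submodule.Quotient.mk_eq_zero _).1 (ha k),
    tupleTensor_eq_sum_iff.1 h⟩

theorem sum_mul_eq_zero_of_mem_content {c : ι → Rᵐᵒᵖ} (hc : ∑ j, c j • m j = 0) {a : ι → R}
    (ha : a ∈ content R m) : ∑ j, a j * unop (c j) = 0 := by
  let ψ : (ι → R) →ₗ[R] R := Fintype.linearCombination R fun j => unop (c j)
  have hψ : Tensor.map M ψ (tupleTensor R m) = 0 := by
    calc Tensor.map M ψ (tupleTensor R m) = ∑ j, tmul R (c j • m j) (1 : R) := by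
          rw [map_tupleTensor]
          refine Finset.sum_congr rfl fun j _ => ?_
          rw [← op_unop (c j), smul_tmul]
          simp [ψ]
      _ = 0 := by rw [← sum_tmul, hc, zero_tmul]
  have hle := content_le (hM.map_mkQ_iInf_ker_eq_zero (fun _ : PUnit => ψ) fun _ => hψ)
  exact iInf_le (fun _ : PUnit => LinearMap.ker ψ) ⟨⟩ (hle ha)

/-- The first map of the stable factorization of `f` has as its coordinates elements of the content
of the values of `f` on a basis. -/
theorem hasStableFactorizations : HasStableFactorizations (⊤ : Submodule Rᵐᵒᵖ M) ⊤ := by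
  classical
  intro F _ _ _ _ f _
  let b := Module.Free.chooseBasis Rᵐᵒᵖ F
  obtain ⟨n, y, a, ha, hm⟩ := hM.exists_eq_sum_content (f ∘ b)
  let u : F →ₗ[Rᵐᵒᵖ] (Fin n → Rᵐᵒᵖ) := b.constr ℕ fun j k => op (a k j)
  have hu (j) (k) : u (b j) k = op (a k j) := by simp only [u, Module.Basis.constr_basis]
  refine ⟨n, u, Fintype.linearCombination Rᵐᵒᵖ y, le_top, b.ext fun j => ?_, fun x hx => ?_,
    fun H _ _ _ _ v g hg => ?_⟩
  · simpa [Fintype.linearCombination_apply, hu] using (hm j).symm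
  · have hrel : ∑ j, b.equivFun x j • (f ∘ b) j = 0 := by
      simp only [Function.comp_apply, ← map_smul, ← map_sum, b.sum_equivFun]
      exact hx
    ext k
    have hk := hM.sum_mul_eq_zero_of_mem_content hrel (ha k)
    simpa [u, Module.Basis.constr_apply_fintype] using congrArg op hk
  · let d := Module.Free.chooseBasis Rᵐᵒᵖ H
    let a' (l) (j) : R := unop (d.equivFun (v (b j)) l)
    have hm' (j) : (f ∘ b) j = ∑ l, op (a' l j) • g (d l) := by
      simp only [a', op_unop, ← map_smul, ← map_sum, d.sum_equivFun]
      exact (LinearMap.congr_fun hg (b j)).symm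
    choose r hr using fun k =>
      (Submodule.mem_span_range_iff_exists_fun R).1 (content_le_span hm' (ha k))
    refine ⟨d.constr ℕ fun l k => op (r k l), b.ext fun j => funext fun k => ?_⟩
    rw [hu, ← hr k]
    simp [Module.Basis.constr_apply_fintype, a']

end IsFlatMittagLeffler

end MLModule

theorem theorem2_general (R : Type u) [Ring R] (M : Type v) [AddCommGroup M] [Module Rᵐᵒᵖ M] :
    (MLModule.IsKappaProjective Rᵐᵒᵖ M (Cardinal.aleph 1) ↔
      MLModule.IsFlat.{u, v, max u w} R M ∧ MLModule.IsMittagLeffler.{u, v, max u w} R M) ∧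
    ∀ κ : Cardinal.{v}, Cardinal.aleph0 < κ → MLModule.IsKappaProjective Rᵐᵒᵖ M κ →
      MLModule.IsFlat.{u, v, w} R M ∧ MLModule.IsMittagLeffler.{u, v, w} R M := by
  simp only [← MLModule.isFlatMittagLeffler_iff]
  refine ⟨⟨fun h => h.isFlatMittagLeffler Cardinal.aleph0_lt_aleph_one, fun h => ?_⟩,
    fun κ hκ h => h.isFlatMittagLeffler hκ⟩
  exact h.lower_universe.hasStableFactorizations.isKappaProjective_aleph_one

/-- `R` is an arbitrary ring, `M` a right `R`-module; the left modules on which flatness and the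
Mittag-Leffler property are tested live in any universe containing those of `R` and `M`. -/
theorem theorem2 (R : Type u) [Ring R] (M : Type v) [AddCommGroup M] [Module Rᵐᵒᵖ M] :
    (MLModule.IsKappaProjective Rᵐᵒᵖ M (Cardinal.aleph 1) ↔
      MLModule.IsFlat.{u, v, max u v w} R M ∧ MLModule.IsMittagLeffler.{u, v, max u v w} R M) ∧
    ∀ κ : Cardinal.{v}, κ.IsRegular → Cardinal.aleph0 < κ →
      MLModule.IsKappaProjective Rᵐᵒᵖ M κ →
        MLModule.IsFlat.{u, v, max u v w} R M ∧ MLModule.IsMittagLeffler.{u, v, max u v w} R M := by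
  obtain ⟨haleph, hκ⟩ := theorem2_general.{u, v, max u v w} R M
  exact ⟨haleph, fun κ _ => hκ κ⟩
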